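/- **Theorem (Privacy of FL-TOP-DP).** Let $\mathbf w_0\in\mathbb R^n$ be a public initial model, $\mathbb T\subseteq\{1,\dots,n\}$ a public set of (Top-$K$) coordinates, $f(\mathbb B;\mathbf w)$ a loss function, and let $S>0$, $\sigma>0$, $C\in(0,1]$, $m>0$, $\eta\in\mathbb R$, $T_{\mathsf{gd}}\ge 0$ and $T_{\mathsf{cl}}\ge 1$ be public parameters. A database is a finite list of clients, each of which holds a finite list of records. FL-TOP-DP runs $T_{\mathsf{cl}}$ rounds. In round $t$: 1. Each client is sampled independently with probability $C$. 2. Each sampled client $k$ receives the coordinates in $\mathbb T$ of the global model $\mathbf w_{t-1}$ and fills in the other coordinates from $\mathbf w_0$. It then performs $T_{\mathsf{gd}}$ stochastic gradient iterations on randomly selected batches of its data (step size $\eta$, updating only the coordinates in $\mathbb T$), and forms the vector $\Delta\mathbf w_t^k\in\mathbb R^{\mathbb T}$ of the resulting change of the weights in $\mathbb T$. It clips this vector to $\Delta\hat{\mathbf w}_t^k=\Delta\mathbf w_t^k/\max(1,\|\Delta\mathbf w_t^k\|_2/S)$. 3. The server obtains only the noisy sum $\mathbf y_t=\sum_{k}\Delta\hat{\mathbf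 w}_t^k+N(0,S^2\sigma^2 I)$ over the sampled clients. It sets $\mathbf w_t=\mathbf w_{t-1}+\mathbf y_t/m$ on $\mathbb T$ and $\mathbf w_t=\mathbf w_0$ elsewhere, where $m$ is the public nominal number of sampled clients. All random choices (sampling, batches, noise) are independent. The output of the mechanism is $(\mathbf y_1,\dots,\mathbf y_{T_{\mathsf{cl}}})$, which determines all the global models. Let $\eta_0$ be the density of $N(0,\sigma^2)$ and $\eta_1$ that of $(1-C)\,N(0,\sigma^2)+C\,N(1,\sigma^2)$. For $\lambda>0$ put $$E_1(\lambda)=\int_{\mathbb R}\eta_0(x)\Big(\frac{\eta_0(x)}{\eta_1(x)}\Big)^{\lambda}dx,\qquad E_2(\lambda)=\int_{\mathbb R}\eta_1(x)\Big(\frac{\eta_1(x)}{\eta_0(x)}\Big)^{\lambda}dx,\qquad \alpha(\lambda|C)=\log\max(E_1(\lambda),E_2(\lambda)).$$ Then for every $\delta\in(0,1)$ the minimum $$\varepsilon=\min_{\lambda>0}\frac{T_{\mathsf{cl}}\cdot\alpha(\lambda|C)-\log\delta}{\lambda}$$ over real $\lambda>0$ exists, and FL-TOP-DP is client-level $(\varepsilon,\delta)$-differentially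 private: for any two databases $D,D'$ of which one arises from the other by adding or removing at most one client, the privacy loss $\log\frac{d\mathcal A(D)}{d\mathcal A(D')}(O)$ (taken as $+\infty$ where $\mathcal A(D')$ has density zero) of an output $O\sim\mathcal A(D)$ satisfies $$\Pr_{O\sim\mathcal A(D)}\Big[\log\tfrac{d\mathcal A(D)}{d\mathcal A(D')}(O)>\varepsilon\Big]\le\delta .$$ -/

import Mathlib

open MeasureTheory ProbabilityTheory
open scoped ENNReal

noncomputable section

namespace FLTop

/-! ### Differential privacy via the privacy loss -/

/-- The privacy loss `log (dμ/dν)` of an output law `μ` against an output law `ν` at the outcome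
`o`. Both densities are taken with respect to the common dominating measure `μ + ν`, so the loss is
`+∞` where only `μ` charges and `-∞` where only `ν` does. -/
def privacyLoss {Ω : Type*} [MeasurableSpace Ω] (μ ν : Measure Ω) (o : Ω) : EReal :=
  ENNReal.log (μ.rnDeriv (μ + ν) o / ν.rnDeriv (μ + ν) o)

/-- A randomized mechanism `A` (a map from databases to output laws) is `(ε, δ)`-differentially
private for the adjacency relation `adj` if, for all adjacent databases `D`, `D'`, the privacy loss
at an output drawn from `A D` exceeds `ε` with probability at most `δ`. -/
def IsDP {𝒟 Ω : Type*} [MeasurableSpace Ω] (adj : 𝒟 → 𝒟 → Prop) (A : 𝒟 → Measure Ω)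
    (ε δ : ℝ) : Prop :=
  ∀ D D' : 𝒟, adj D D' →
    A D {o | (ε : EReal) < privacyLoss (A D) (A D') o} ≤ ENNReal.ofReal δ

/-- The database of one client: a finite list of training records. -/
abbrev ClientData (X : Type*) := List X

/-- A database: the list of all participating clients. -/
abbrev Database (X : Type*) := List (ClientData X)

/-- Client-level adjacency: the databases differ in the participation of at most one client. -/
def ClientAdjacent {X : Type*} (D D' : Database X) : Prop :=
  D = D' ∨ ∃ (l₁ l₂ : Database X) (d : ClientData X),
    (D = l₁ ++ d :: l₂ ∧ D' = l₁ ++ l₂) ∨ (D = l₁ ++ l₂ ∧ D' = l₁ ++ d :: l₂)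

/-! ### The protocol -/

/-- Weight vectors of a model with `n` parameters. -/
abbrev Weights (n : ℕ) := EuclideanSpace ℝ (Fin n)

/-- Compressed vectors: only the coordinates in `𝕋`. -/
abbrev Compressed {n : ℕ} (𝕋 : Finset (Fin n)) := EuclideanSpace ℝ 𝕋

/-- The public parameters of the protocol. -/
structure Params (X : Type*) (n : ℕ) where
  /-- the Top-`K` coordinates, selected from public data -/
  top : Finset (Fin n)
  /-- the public initial model -/
  w₀ : Weights n
  /-- the loss of a batch of records at given weights -/
  loss : Multiset X → Weights n → ℝ
  /-- the local learning rate -/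
  η : ℝ
  /-- the number of local gradient descent iterations -/
  Tgd : ℕ
  /-- the law by which a client with local data `d` selects (the positions of) a batch -/
  batchLaw : (d : ClientData X) → PMF (Finset (Fin d.length))
  /-- the clipping threshold -/
  S : ℝ
  S_pos : 0 < S
  /-- the noise multiplier -/
  σ : ℝ
  σ_pos : 0 < σ
  /-- the probability with which each client is sampled in each round -/
  C : ℝ
  C_pos : 0 < C
  C_le_one : C ≤ 1
  /-- the public (nominal) number of sampled clients by which the server divides the sum -/
  m : ℝ
  m_pos : 0 < m
  /-- the number of rounds -/
  Tcl : ℕ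

section Vectors

variable {n : ℕ} (𝕋 : Finset (Fin n))

/-- The compression operator: keep the coordinates in `𝕋`. -/
def compress (w : Weights n) : Compressed 𝕋 := WithLp.toLp 2 fun i => w i

/-- The weight vector with the given values on `𝕋` and the values of `w₀` elsewhere. -/
def expand (w₀ : Weights n) (v : Compressed 𝕋) : Weights n :=
  WithLp.toLp 2 fun i => if h : i ∈ 𝕋 then v ⟨i, h⟩ else w₀ i

/-- Clipping to Euclidean norm at most `S`. -/
def clip (S : ℝ) (v : Compressed 𝕋) : Compressed 𝕋 := (max 1 (‖v‖ / S))⁻¹ • v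

/-- The law of Gaussian noise with independent `N(0, s²)` coordinates. -/
def gaussianNoise (s : ℝ) : Measure (Compressed 𝕋) :=
  (Measure.pi fun _ : 𝕋 => gaussianReal 0 (s ^ 2).toNNReal).map (WithLp.toLp 2)

instance (s : ℝ) : IsProbabilityMeasure (gaussianNoise 𝕋 s) :=
  Measure.isProbabilityMeasure_map (by fun_prop)

@[fun_prop]
lemma measurable_compress : Measurable (compress 𝕋) := by
  unfold compress
  fun_prop

@[fun_prop]
lemma measurable_expand (w₀ : Weights n) : Measurable (expand 𝕋 w₀) := by
  refine (WithLp.measurable_toLp 2 _).comp (measurable_pi_iff.2 fun i => ?_)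
  by_cases h : i ∈ 𝕋
  · simp only [h, dite_true]; fun_prop
  · simp only [h, dite_false]; fun_prop

@[fun_prop]
lemma measurable_clip (S : ℝ) : Measurable (clip 𝕋 S) := by
  unfold clip
  fun_prop

end Vectors

namespace Params

variable {X : Type*} {n : ℕ} (P : Params X n)

/-- The records of the local data `d` at the positions `B`. -/
def batch (d : ClientData X) (B : Finset (Fin d.length)) : Multiset X := B.val.map d.get

/-- One local gradient step on the batch at positions `B`, updating the coordinates in `𝕋` only. -/
def sgdStep (d : ClientData X) (B : Finset (Fin d.length)) (w : Weights n) : Weights n :=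
  WithLp.toLp 2 fun i =>
    if i ∈ P.top then w i + (-P.η • gradient (P.loss (batch d B)) w) i else w i

lemma measurable_sgdStep (d : ClientData X) (B : Finset (Fin d.length)) :
    Measurable (P.sgdStep d B) := by
  have hg : Measurable fun w => gradient (P.loss (batch d B)) w := by
    unfold gradient
    exact (LinearIsometryEquiv.continuous _).measurable.comp (measurable_fderiv ℝ _)
  refine (WithLp.measurable_toLp 2 _).comp (measurable_pi_iff.2 fun i => ?_)
  by_cases h : i ∈ P.top
  · simp only [h, if_true]; fun_prop
  · simp only [h, if_false]; fun_prop

/-- One iteration of local training: select a random batch and make a gradient step on it. -/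
def sgdStepKernel (d : ClientData X) : Kernel (Weights n) (Weights n) where
  toFun w := ∑ B, P.batchLaw d B • Measure.dirac (P.sgdStep d B w)
  measurable' := by
    refine Measure.measurable_of_measurable_coe _ fun s hs => ?_
    simp only [Measure.finsetSum_apply, Measure.smul_apply, smul_eq_mul]
    refine Finset.measurable_sum _ fun B _ => Measurable.const_mul ?_ _
    exact (Measure.measurable_coe hs).comp (Measure.measurable_dirac.comp (P.measurable_sgdStep d B))

instance (d : ClientData X) : IsMarkovKernel (P.sgdStepKernel d) := by
  refine ⟨fun w => ⟨?_⟩⟩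
  have h := (P.batchLaw d).tsum_coe
  rw [tsum_fintype] at h
  simpa [sgdStepKernel] using h

/-- Local training from weights `w`: `t` iterations of Top-`K` stochastic gradient descent. -/
def sgdKernel (d : ClientData X) : ℕ → Kernel (Weights n) (Weights n)
  | 0 => Kernel.id
  | t + 1 => P.sgdStepKernel d ∘ₖ sgdKernel d t

instance (d : ClientData X) (t : ℕ) : IsMarkovKernel (P.sgdKernel d t) := by
  induction t with
  | zero => unfold sgdKernel; infer_instance
  | succ t ih => unfold sgdKernel; infer_instance

/-- A sampled client, on receiving the compressed model `v`: rebuild the full weight vector, train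
locally, compress the update to the coordinates `𝕋`, and clip it to norm `S`. This is the law of
the clipped update. -/
def clientKernel (d : ClientData X) : Kernel (Compressed P.top) (Compressed P.top) where
  toFun v := (P.sgdKernel d P.Tgd (expand P.top P.w₀ v)).map
    fun w' => clip P.top P.S (compress P.top (w' - expand P.top P.w₀ v))
  measurable' := by
    have key : (fun v => (P.sgdKernel d P.Tgd (expand P.top P.w₀ v)).map
        fun w' => clip P.top P.S (compress P.top (w' - expand P.top P.w₀ v))) =
        ((Kernel.id ×ₖ (P.sgdKernel d P.Tgd).comap _ (measurable_expand P.top P.w₀)).map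
          fun q => clip P.top P.S (compress P.top (q.2 - expand P.top P.w₀ q.1))) := by
      funext v
      rw [Kernel.map_apply _ (by fun_prop), Kernel.prod_apply, Kernel.id_apply,
        Measure.dirac_prod, Measure.map_map (by fun_prop) (by fun_prop)]
      rfl
    rw [key]
    exact Kernel.measurable _

instance (d : ClientData X) : IsMarkovKernel (P.clientKernel d) :=
  ⟨fun _ => Measure.isProbabilityMeasure_map (by fun_prop)⟩

/-- The contribution of a client to the sum of a round: independently of everything else, the
client is sampled with probability `C` and then contributes its clipped update; otherwise it
contributes nothing. -/
def contributionKernel (d : ClientData X) : Kernel (Compressed P.top) (Compressed P.top) where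
  toFun v := ENNReal.ofReal (1 - P.C) • Measure.dirac 0 + ENNReal.ofReal P.C • P.clientKernel d v
  measurable' := by
    refine Measure.measurable_of_measurable_coe _ fun s hs => ?_
    simp only [Measure.add_apply, Measure.smul_apply, smul_eq_mul]
    exact measurable_const.add (((P.clientKernel d).measurable_coe hs).const_mul _)

instance (d : ClientData X) : IsMarkovKernel (P.contributionKernel d) := by
  refine ⟨fun v => ⟨?_⟩⟩
  have h1 := P.C_le_one
  have h0 := P.C_pos
  simp only [contributionKernel, Kernel.coe_mk, Measure.add_apply, Measure.smul_apply,
    measure_univ, smul_eq_mul, mul_one]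
  rw [← ENNReal.ofReal_add (by linarith) h0.le]
  simp

/-- The law of the sum of independent random vectors drawn from `κ a` and `ξ a`. -/
def _root_.FLTop.sumKernel {α E : Type*} [MeasurableSpace α] [MeasurableSpace E] [Add E]
    (κ ξ : Kernel α E) : Kernel α E :=
  (κ ×ₖ ξ).map fun q => q.1 + q.2

instance _root_.FLTop.sumKernel.instIsMarkovKernel {α E : Type*} [MeasurableSpace α]
    [MeasurableSpace E] [Add E] [MeasurableAdd₂ E] (κ ξ : Kernel α E) [IsMarkovKernel κ]
    [IsMarkovKernel ξ] : IsMarkovKernel (sumKernel κ ξ) :=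
  Kernel.IsMarkovKernel.map _ measurable_add

/-- The law of the sum of the clipped updates of the sampled clients, given the compressed
model: the sum of the independent contributions of all clients. -/
def sumOfUpdates : Database X → Kernel (Compressed P.top) (Compressed P.top)
  | [] => Kernel.const _ (Measure.dirac 0)
  | d :: D => sumKernel (P.contributionKernel d) (sumOfUpdates D)

instance (D : Database X) : IsMarkovKernel (P.sumOfUpdates D) := by
  induction D with
  | nil => unfold sumOfUpdates; infer_instance
  | cons d D ih => unfold sumOfUpdates; infer_instance

/-- What the server obtains in a round started with the compressed model `v`: the sum of the clipped
updates of the sampled clients plus Gaussian noise with covariance `S²σ²I`. -/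
def roundKernel (D : Database X) : Kernel (Compressed P.top) (Compressed P.top) :=
  sumKernel (P.sumOfUpdates D) (Kernel.const _ (gaussianNoise P.top (P.S * P.σ)))

instance (D : Database X) : IsMarkovKernel (P.roundKernel D) := by
  unfold roundKernel
  infer_instance

/-- The server's update of the global model `w` after receiving the noisy sum `y`. -/
def serverUpdate (w : Weights n) (y : Compressed P.top) : Weights n :=
  WithLp.toLp 2 fun i => if h : i ∈ P.top then w i + y ⟨i, h⟩ / P.m else P.w₀ i

lemma measurable_serverUpdate :
    Measurable fun q : Weights n × Compressed P.top => P.serverUpdate q.1 q.2 := by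
  refine (WithLp.measurable_toLp 2 _).comp (measurable_pi_iff.2 fun i => ?_)
  by_cases h : i ∈ P.top
  · simp only [h, dite_true]; fun_prop
  · simp only [h, dite_false]; fun_prop

/-- The noisy sums received in `t` rounds of the protocol started from the global model `w`. In each
round the clients receive the current compressed model, and the server updates the global model with
the noisy sum, on which the later rounds depend. -/
def viewKernel (D : Database X) : (t : ℕ) → Kernel (Weights n) (Fin t → Compressed P.top)
  | 0 => Kernel.const _ (Measure.dirac Fin.elim0)
  | t + 1 =>
    ((P.roundKernel D).comap (compress P.top) (measurable_compress P.top) ⊗ₖ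
      (viewKernel D t).comap (fun q => P.serverUpdate q.1 q.2) P.measurable_serverUpdate).map
        fun q => Fin.cons q.1 q.2

lemma _root_.FLTop.measurable_cons {E : Type*} [MeasurableSpace E] (t : ℕ) :
    Measurable fun q : E × (Fin t → E) => (Fin.cons q.1 q.2 : Fin (t + 1) → E) := by
  refine measurable_pi_iff.2 fun i => ?_
  induction i using Fin.cases with
  | zero => simpa using measurable_fst
  | succ i => simpa [Function.comp_def] using (measurable_pi_apply i).comp measurable_snd

instance (D : Database X) (t : ℕ) : IsMarkovKernel (P.viewKernel D t) := by
  induction t with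
  | zero => unfold viewKernel; infer_instance
  | succ t ih => unfold viewKernel; exact Kernel.IsMarkovKernel.map _ (measurable_cons t)

/-- FL-TOP-DP as a randomized mechanism: the law of everything that is released about the clients in
`Tcl` rounds, that is of the sequence of noisy sums (which determines all global models). -/
def mechanism (D : Database X) : Measure (Fin P.Tcl → Compressed P.top) :=
  P.viewKernel D P.Tcl P.w₀

end Params

/-! ### The moments accountant -/

/-- The density of `N(0, σ²)`. -/
def eta0 (σ x : ℝ) : ℝ := gaussianPDFReal 0 (σ ^ 2).toNNReal x

/-- The density of `(1 - C) N(0, σ²) + C N(1, σ²)`. -/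
def eta1 (C σ x : ℝ) : ℝ :=
  (1 - C) * gaussianPDFReal 0 (σ ^ 2).toNNReal x +
    C * gaussianPDFReal 1 (σ ^ 2).toNNReal x

/-- The moment of the privacy loss of `η₀` against `η₁`. -/
def E1 (lam C σ : ℝ) : ℝ := ∫ x, eta0 σ x * (eta0 σ x / eta1 C σ x) ^ lam

/-- The moment of the privacy loss of `η₁` against `η₀`. -/
def E2 (lam C σ : ℝ) : ℝ := ∫ x, eta1 C σ x * (eta1 C σ x / eta0 σ x) ^ lam

/-- The log moment `α(λ | C)`. -/
def alpha (lam C σ : ℝ) : ℝ := Real.log (max (E1 lam C σ) (E2 lam C σ))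

end FLTop

end

noncomputable section

namespace FLTop

/-! This is the moments accountant, run without densities. With `p = 1 + lam` and its conjugate `q =
(1 + lam) / lam`, a bound `M` on the `lam`-th moment of the privacy loss says that the density of
`μ` against `ν` has `L^p(ν)` norm at most `M ^ (1 / p)`. `HolderBound` tests this against functions
in `L^q(ν)`, a form that passes directly through pushforwards, mixtures and kernel compositions.

One round: the contributions of the common clients are an independent summand and can be dropped
(`HolderBound.conv_left`). Given the clipped update `u` of the extra client, it remains to compare
`N(0, S²σ²I)` with its mixture with a shift by `u`. As `‖u‖ ≤ S`, the covariance `S²σ²I - σ²uuᵀ` is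
nonnegative, so the noise is `ξu + Z` with `ξ ~ N(0, σ²)` and `Z` independent
(`gaussianReal_map_smul_conv_gaussianNoise`). Both laws are then images of `η₀` and `η₁` under the
same randomized map `x ↦ xu + Z`, and `E1`, `E2` bound the two directions. Averaging over `u` costs
nothing (`HolderBound.bind`).

The round bound is uniform in the received model, so constants multiply under adaptive composition
(`holderBound_viewKernel`). Testing on the event of large loss gives the tail `exp(Tα - ε lam)`. The
minimum exists because the objective is continuous and blows up at `0` and at `∞`. -/

/-! ### Hölder domination of measures -/

/-- The dual form of a bound on the moment of order `q / (q - 1)` of the density of `μ` with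
respect to `ν`. -/
def HolderBound {Ω : Type*} [MeasurableSpace Ω] (K : ℝ≥0∞) (q : ℝ) (μ ν : Measure Ω) : Prop :=
  ∀ g : Ω → ℝ≥0∞, Measurable g → ∫⁻ x, g x ∂μ ≤ K * (∫⁻ x, g x ^ q ∂ν) ^ (1 / q)

section HolderBound

variable {Ω Ω' : Type*} [MeasurableSpace Ω] [MeasurableSpace Ω'] {q : ℝ} {K : ℝ≥0∞}
  {μ ν : Measure Ω}

lemma lintegral_le_lintegral_rpow [IsProbabilityMeasure μ] (hq : 1 < q) {g : Ω → ℝ≥0∞}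
    (hg : AEMeasurable g μ) : ∫⁻ x, g x ∂μ ≤ (∫⁻ x, g x ^ q ∂μ) ^ (1 / q) := by
  simpa using ENNReal.lintegral_mul_le_Lp_mul_Lq μ (Real.HolderConjugate.conjExponent hq) hg
    (aemeasurable_const (b := (1 : ℝ≥0∞)))

lemma HolderBound.refl [IsProbabilityMeasure μ] (hq : 1 < q) : HolderBound 1 q μ μ :=
  fun g hg => by simpa using lintegral_le_lintegral_rpow hq hg.aemeasurable

lemma HolderBound.mono {K' : ℝ≥0∞} (h : HolderBound K q μ ν) (hK : K ≤ K') :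
    HolderBound K' q μ ν :=
  fun g hg => (h g hg).trans (by gcongr)

lemma HolderBound.one_le [IsProbabilityMeasure μ] [IsProbabilityMeasure ν]
    (h : HolderBound K q μ ν) : 1 ≤ K := by
  simpa using h (fun _ => 1) measurable_const

lemma HolderBound.map (h : HolderBound K q μ ν) {φ : Ω → Ω'} (hφ : Measurable φ) :
    HolderBound K q (μ.map φ) (ν.map φ) := fun g hg => by
  rw [lintegral_map hg hφ, lintegral_map (by fun_prop) hφ]
  exact h _ (hg.comp hφ)

/-- The inner bound produces an outer test function that is a `1/q`-th power; the outer bound raises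
it to the power `q` again, so the two cancel and the constants multiply. -/
lemma HolderBound.compProd {K' : ℝ≥0∞} [SFinite μ] [SFinite ν] {κ κ' : Kernel Ω Ω'}
    [IsSFiniteKernel κ] [IsSFiniteKernel κ'] (hq : 1 < q) (h : HolderBound K q μ ν)
    (hκ : ∀ x, HolderBound K' q (κ x) (κ' x)) :
    HolderBound (K * K') q (μ ⊗ₘ κ) (ν ⊗ₘ κ') := fun g hg => by
  have hm : Measurable fun x => ∫⁻ y, g (x, y) ^ q ∂κ' x :=
    (hg.pow_const q).lintegral_kernel_prod_right'
  rw [Measure.lintegral_compProd hg, Measure.lintegral_compProd (hg.pow_const q)]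
  calc ∫⁻ x, ∫⁻ y, g (x, y) ∂κ x ∂μ
      ≤ ∫⁻ x, K' * (∫⁻ y, g (x, y) ^ q ∂κ' x) ^ (1 / q) ∂μ :=
        lintegral_mono fun x => hκ x _ (by fun_prop)
    _ = K' * ∫⁻ x, (∫⁻ y, g (x, y) ^ q ∂κ' x) ^ (1 / q) ∂μ :=
        lintegral_const_mul _ (by fun_prop)
    _ ≤ K' * (K * (∫⁻ x, ((∫⁻ y, g (x, y) ^ q ∂κ' x) ^ (1 / q)) ^ q ∂ν) ^ (1 / q)) := by
        gcongr
        exact h _ (by fun_prop)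
    _ = _ := by
        simp_rw [← ENNReal.rpow_mul, one_div_mul_cancel (by positivity : q ≠ 0), ENNReal.rpow_one]
        ring

/-- Both mixtures use the same mixing law, so Jensen's inequality for the power `1/q` suffices and
the constant does not grow. -/
lemma HolderBound.bind {ρ : Measure Ω'} [IsProbabilityMeasure ρ] {κ κ' : Ω' → Measure Ω}
    (hq : 1 < q) (hκ : Measurable κ) (hκ' : Measurable κ')
    (h : ∀ᵐ u ∂ρ, HolderBound K q (κ u) (κ' u)) :
    HolderBound K q (ρ.bind κ) (ρ.bind κ') := fun g hg => by
  have hm : Measurable fun x => ∫⁻ y, g y ^ q ∂κ' x :=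
    (Measure.measurable_lintegral (by fun_prop)).comp hκ'
  rw [Measure.lintegral_bind hκ.aemeasurable hg.aemeasurable,
    Measure.lintegral_bind hκ'.aemeasurable (by fun_prop)]
  calc ∫⁻ x, ∫⁻ y, g y ∂κ x ∂ρ
      ≤ ∫⁻ x, K * (∫⁻ y, g y ^ q ∂κ' x) ^ (1 / q) ∂ρ :=
        lintegral_mono_ae (h.mono fun x hx => hx g hg)
    _ = K * ∫⁻ x, (∫⁻ y, g y ^ q ∂κ' x) ^ (1 / q) ∂ρ :=
        lintegral_const_mul _ (by fun_prop)
    _ ≤ K * (∫⁻ x, ((∫⁻ y, g y ^ q ∂κ' x) ^ (1 / q)) ^ q ∂ρ) ^ (1 / q) := by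
        gcongr
        exact lintegral_le_lintegral_rpow hq (by fun_prop)
    _ = _ := by
        simp_rw [← ENNReal.rpow_mul, one_div_mul_cancel (by positivity : q ≠ 0), ENNReal.rpow_one]

lemma HolderBound.conv_left {E : Type*} [MeasurableSpace E] [AddMonoid E] [MeasurableAdd₂ E]
    {μ ν ρ : Measure E} [IsProbabilityMeasure μ] [IsProbabilityMeasure ν] [IsProbabilityMeasure ρ]
    (hq : 1 < q) (h : HolderBound K q μ ν) :
    HolderBound K q (ρ.conv μ) (ρ.conv ν) := by
  have := ((HolderBound.refl (μ := ρ) hq).compProd (κ := Kernel.const E μ)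
    (κ' := Kernel.const E ν) hq fun _ => by simpa using h).map measurable_add
  simpa [Measure.compProd_const, Measure.conv] using this

/-- Densities with a bounded moment of their ratio. -/
lemma HolderBound.of_density {f h : Ω → ℝ} (hf : Measurable f) (hh : Measurable h)
    (hf0 : ∀ x, 0 < f x) (hh0 : ∀ x, 0 < h x) {lam : ℝ} (hlam : 0 < lam)
    (hint : Integrable (fun x => f x * (f x / h x) ^ lam) μ) :
    HolderBound (ENNReal.ofReal (∫ x, f x * (f x / h x) ^ lam ∂μ) ^ (1 / (1 + lam)))
      ((1 + lam) / lam) (μ.withDensity fun x => ENNReal.ofReal (f x))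
      (μ.withDensity fun x => ENNReal.ofReal (h x)) := fun g hg => by
  have hpq : (1 + lam).HolderConjugate ((1 + lam) / lam) := by
    rw [Real.holderConjugate_iff]
    refine ⟨by linarith, ?_⟩
    field_simp
  -- Hölder's inequality for `f / h` and `g` under the law with density `h`.
  have key := ENNReal.lintegral_mul_le_Lp_mul_Lq
    (μ.withDensity fun x => ENNReal.ofReal (h x)) hpq
    (f := fun x => ENNReal.ofReal (f x / h x)) (g := g) (by fun_prop) (by fun_prop)
  rw [lintegral_withDensity_eq_lintegral_mul _ (by fun_prop) (by fun_prop),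
    lintegral_withDensity_eq_lintegral_mul _ (by fun_prop) (by fun_prop)] at key
  rw [lintegral_withDensity_eq_lintegral_mul _ (by fun_prop) (by fun_prop)]
  convert key using 3
  · simp only [Pi.mul_apply]
    rw [← mul_assoc, ← ENNReal.ofReal_mul (hh0 _).le, mul_div_cancel₀ _ (hh0 _).ne']
  · rw [ofReal_integral_eq_lintegral_ofReal hint (.of_forall fun x =>
      mul_nonneg (hf0 x).le (Real.rpow_nonneg (div_nonneg (hf0 x).le (hh0 x).le) _))]
    refine lintegral_congr fun x => ?_
    have hr : 0 < f x / h x := div_pos (hf0 x) (hh0 x)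
    simp only [Pi.mul_apply]
    rw [ENNReal.ofReal_rpow_of_pos hr, ← ENNReal.ofReal_mul (hh0 x).le, Real.rpow_add hr,
      Real.rpow_one, ← mul_assoc, mul_div_cancel₀ _ (hh0 x).ne']

/-- On this event the density of `ν` is at most `exp (-ε)` times that of `μ`, both taken against `μ
+ ν`; integrate. -/
lemma measure_mul_exp_le_of_lt_privacyLoss [IsFiniteMeasure μ] [IsFiniteMeasure ν] (ε : ℝ) :
    ν {o | (ε : EReal) < privacyLoss μ ν o} ≤
      ENNReal.ofReal (Real.exp (-ε)) * μ {o | (ε : EReal) < privacyLoss μ ν o} := by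
  set B := {o | (ε : EReal) < privacyLoss μ ν o} with hB
  have hBm : MeasurableSet B := measurableSet_lt measurable_const
    (ENNReal.measurable_log.comp
      ((Measure.measurable_rnDeriv _ _).div (Measure.measurable_rnDeriv _ _)))
  rw [← Measure.setLIntegral_rnDeriv' (μ := ν) (ν := μ + ν)
      (Measure.absolutelyContinuous_of_le (Measure.le_add_left le_rfl)) hBm,
    ← Measure.setLIntegral_rnDeriv' (μ := μ) (ν := μ + ν)
      (Measure.absolutelyContinuous_of_le (Measure.le_add_right le_rfl)) hBm,
    ← lintegral_const_mul _ (Measure.measurable_rnDeriv _ _)]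
  refine setLIntegral_mono (by fun_prop) fun o ho => ?_
  have h1 : ENNReal.ofReal (Real.exp ε) < μ.rnDeriv (μ + ν) o / ν.rnDeriv (μ + ν) o := by
    rw [← ENNReal.log_lt_log_iff, ENNReal.log_ofReal_of_pos (Real.exp_pos _), Real.log_exp]
    exact ho
  have h2 := ENNReal.mul_le_of_le_div h1.le
  calc ν.rnDeriv (μ + ν) o
      = ENNReal.ofReal (Real.exp (-ε)) *
          (ENNReal.ofReal (Real.exp ε) * ν.rnDeriv (μ + ν) o) := by
        rw [← mul_assoc, ← ENNReal.ofReal_mul (Real.exp_pos _).le, ← Real.exp_add]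
        simp
    _ ≤ _ := by gcongr

/-- The tail bound of the moments accountant. -/
lemma HolderBound.measure_lt_privacyLoss_le [IsFiniteMeasure μ] [IsFiniteMeasure ν] {lam M : ℝ}
    (hlam : 0 < lam) (hM : 0 ≤ M)
    (h : HolderBound (ENNReal.ofReal M ^ (1 / (1 + lam))) ((1 + lam) / lam) μ ν) (ε : ℝ) :
    μ {o | (ε : EReal) < privacyLoss μ ν o} ≤ ENNReal.ofReal (M * Real.exp (-(ε * lam))) := by
  set B := {o | (ε : EReal) < privacyLoss μ ν o} with hB
  have hBm : MeasurableSet B := measurableSet_lt measurable_const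
    (ENNReal.measurable_log.comp
      ((Measure.measurable_rnDeriv _ _).div (Measure.measurable_rnDeriv _ _)))
  have hq : 0 < (1 + lam) / lam := by positivity
  -- Testing on the bad event bounds `μ B` by a power of `ν B`, which is in turn at most `exp (-ε) *
  -- μ B`; the resulting inequality is solved for `μ B`.
  have h1 := h (B.indicator fun _ => 1) (measurable_const.indicator hBm)
  have h2 : (fun x => (B.indicator (fun _ => (1 : ℝ≥0∞)) x) ^ ((1 + lam) / lam)) =
      B.indicator fun _ => 1 := by
    funext x
    by_cases hx : x ∈ B <;> simp [hx, hq]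
  rw [h2, lintegral_indicator_const hBm, lintegral_indicator_const hBm, one_mul, one_mul] at h1
  have h3 := measure_mul_exp_le_of_lt_privacyLoss (μ := μ) (ν := ν) ε
  rw [← hB] at h3
  have hfin : μ B ≠ ∞ := measure_ne_top _ _
  obtain ⟨b, hb⟩ : ∃ b, b = (μ B).toReal := ⟨_, rfl⟩
  have hb0 : 0 ≤ b := hb ▸ ENNReal.toReal_nonneg
  have hμ : μ B = ENNReal.ofReal b := by rw [hb, ENNReal.ofReal_toReal hfin]
  have h4 : ENNReal.ofReal b ≤ ENNReal.ofReal
      (M ^ (1 / (1 + lam)) * (Real.exp (-ε) * b) ^ (1 / ((1 + lam) / lam))) := by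
    calc ENNReal.ofReal b = μ B := hμ.symm
      _ ≤ _ := h1
      _ ≤ ENNReal.ofReal M ^ (1 / (1 + lam)) *
          (ENNReal.ofReal (Real.exp (-ε)) * μ B) ^ (1 / ((1 + lam) / lam)) := by gcongr
      _ = _ := by
        rw [hμ, ENNReal.ofReal_mul (by positivity), ← ENNReal.ofReal_mul (by positivity),
          ENNReal.ofReal_rpow_of_nonneg hM (by positivity),
          ENNReal.ofReal_rpow_of_nonneg (by positivity) (by positivity)]
  rw [ENNReal.ofReal_le_ofReal_iff (by positivity)] at h4
  rw [hμ]
  refine ENNReal.ofReal_le_ofReal ?_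
  rcases hb0.eq_or_lt with rfl | hbpos
  · positivity
  have h5 : b ^ (1 + lam) ≤ M * Real.exp (-(ε * lam)) * b ^ lam := by
    calc b ^ (1 + lam)
        ≤ (M ^ (1 / (1 + lam)) * (Real.exp (-ε) * b) ^ (1 / ((1 + lam) / lam))) ^ (1 + lam) := by
          gcongr
      _ = M * (Real.exp (-ε) * b) ^ lam := by
          rw [Real.mul_rpow (by positivity) (by positivity), ← Real.rpow_mul hM,
            ← Real.rpow_mul (by positivity)]
          congr 2
          · rw [one_div_mul_cancel (by positivity), Real.rpow_one]
          · field_simp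
      _ = _ := by
          rw [Real.mul_rpow (by positivity) (by positivity), ← Real.exp_mul]
          ring_nf
  rw [Real.rpow_add hbpos, Real.rpow_one] at h5
  exact le_of_mul_le_mul_right h5 (by positivity)

end HolderBound

/-! ### Splitting a spherical Gaussian along a direction -/

section Gaussian

variable {n : ℕ} {𝕋 : Finset (Fin n)}

lemma charFun_gaussianNoise (s : ℝ) (t : Compressed 𝕋) :
    charFun (gaussianNoise 𝕋 s) t = Complex.exp (-((s ^ 2 * ‖t‖ ^ 2 / 2 : ℝ) : ℂ)) := by
  unfold gaussianNoise
  rw [charFun_pi]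
  simp_rw [charFun_gaussianReal]
  rw [← Complex.exp_sum, EuclideanSpace.norm_sq_eq]
  congr 1
  rw [Real.coe_toNNReal _ (sq_nonneg s)]
  push_cast
  rw [Finset.mul_sum, Finset.sum_div, ← Finset.sum_neg_distrib]
  refine Finset.sum_congr rfl fun i _ => ?_
  simp [← Complex.ofReal_pow, sq_abs]

/-- The coefficient of the component along `u` that is removed from a Gaussian vector. -/
def splitCoeff (S : ℝ) (u : Compressed 𝕋) : ℝ := (S ^ 2 * (1 + √(1 - ‖u‖ ^ 2 / S ^ 2)))⁻¹

/-- Removal of the component along `u` of a spherical Gaussian vector. -/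
def splitMap (S : ℝ) (u y : Compressed 𝕋) : Compressed 𝕋 :=
  y - (splitCoeff S u * inner ℝ u y) • u

@[fun_prop]
lemma measurable_splitMap (S : ℝ) (u : Compressed 𝕋) : Measurable (splitMap S u) := by
  unfold splitMap
  fun_prop

lemma inner_splitMap (S : ℝ) (u y t : Compressed 𝕋) :
    inner ℝ (splitMap S u y) t = inner ℝ y (splitMap S u t) := by
  simp only [splitMap, inner_sub_left, inner_sub_right, real_inner_smul_left,
    real_inner_smul_right]
  rw [real_inner_comm y u]
  ring

/-- `splitMap` is the square root of `I - uuᵀ/S²`. With `r = √(1 - ‖u‖²/S²)` its coefficient is `(1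
- r)/‖u‖²`, written as `1/(S²(1 + r))` so that `u = 0` is no exception; `‖u‖ ≤ S` makes `r` a
genuine root. -/
lemma norm_sq_splitMap {S : ℝ} (hS : 0 < S) {u : Compressed 𝕋} (hu : ‖u‖ ≤ S)
    (t : Compressed 𝕋) :
    S ^ 2 * ‖splitMap S u t‖ ^ 2 = S ^ 2 * ‖t‖ ^ 2 - inner ℝ u t ^ 2 := by
  have h0 : 0 ≤ 1 - ‖u‖ ^ 2 / S ^ 2 := by
    rw [sub_nonneg, div_le_one (by positivity)]
    gcongr
  set r := √(1 - ‖u‖ ^ 2 / S ^ 2) with hr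
  have hr2 : r ^ 2 = 1 - ‖u‖ ^ 2 / S ^ 2 := Real.sq_sqrt h0
  have hu2 : ‖u‖ ^ 2 = S ^ 2 * (1 - r ^ 2) := by rw [hr2]; field_simp; ring
  have hr0 : 0 ≤ r := Real.sqrt_nonneg _
  have hc : splitCoeff S u = (S ^ 2 * (1 + r))⁻¹ := rfl
  have h1 : ‖splitMap S u t‖ ^ 2 = ‖t‖ ^ 2 - 2 * splitCoeff S u * inner ℝ u t ^ 2 +
      splitCoeff S u ^ 2 * inner ℝ u t ^ 2 * ‖u‖ ^ 2 := by
    rw [splitMap, norm_sub_sq_real, real_inner_smul_right, norm_smul, mul_pow, Real.norm_eq_abs,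
      sq_abs, real_inner_comm u t]
    ring
  rw [h1, hu2, hc]
  field_simp
  ring

/-- A one-dimensional Gaussian in direction `u`, completed by independent noise, gives the
spherical Gaussian shifted along `u`. -/
lemma gaussianReal_map_smul_conv_gaussianNoise {S σ : ℝ} (hS : 0 < S) {u : Compressed 𝕋}
    (hu : ‖u‖ ≤ S) (m : ℝ) :
    ((gaussianReal m (σ ^ 2).toNNReal).map fun x => x • u).conv
      ((gaussianNoise 𝕋 (S * σ)).map (splitMap S u)) =
    (gaussianNoise 𝕋 (S * σ)).map fun y => m • u + y := by
  have := Measure.isProbabilityMeasure_map (μ := gaussianReal m (σ ^ 2).toNNReal)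
    (f := fun x => x • u) (by fun_prop)
  have := Measure.isProbabilityMeasure_map (μ := gaussianNoise 𝕋 (S * σ))
    (f := splitMap S u) (by fun_prop)
  have := Measure.isProbabilityMeasure_map (μ := gaussianNoise 𝕋 (S * σ))
    (f := fun y => m • u + y) (by fun_prop)
  refine Measure.ext_of_charFun ?_
  funext t
  have h1 : charFun ((gaussianReal m (σ ^ 2).toNNReal).map fun x => x • u) t =
      charFun (gaussianReal m (σ ^ 2).toNNReal) (inner ℝ u t) := by
    rw [charFun_apply, charFun_apply_real, integral_map (by fun_prop) (by fun_prop)]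
    refine integral_congr_ae (.of_forall fun x => ?_)
    simp only [real_inner_smul_left]
    push_cast
    ring_nf
  have h2 : charFun ((gaussianNoise 𝕋 (S * σ)).map (splitMap S u)) t =
      charFun (gaussianNoise 𝕋 (S * σ)) (splitMap S u t) := by
    rw [charFun_apply, charFun_apply, integral_map (by fun_prop) (by fun_prop)]
    simp_rw [inner_splitMap]
  -- The variance removed in direction `t` is exactly what the one-dimensional Gaussian along `u`
  -- supplies.
  have h3 : S ^ 2 * σ ^ 2 * ‖splitMap S u t‖ ^ 2 =
      S ^ 2 * σ ^ 2 * ‖t‖ ^ 2 - σ ^ 2 * inner ℝ u t ^ 2 := by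
    linear_combination σ ^ 2 * norm_sq_splitMap hS hu t
  rw [charFun_conv, h1, h2, charFun_map_const_add, charFun_gaussianReal, charFun_gaussianNoise,
    charFun_gaussianNoise, ← Complex.exp_add, ← Complex.exp_add,
    Real.coe_toNNReal _ (sq_nonneg σ), mul_pow, h3, real_inner_smul_left]
  congr 1
  push_cast
  ring

/-- The Gaussian law with a random shift by `u`, made with probability `C`. -/
def shiftMixture (C s : ℝ) (u : Compressed 𝕋) : Measure (Compressed 𝕋) :=
  ENNReal.ofReal (1 - C) • gaussianNoise 𝕋 s +
    ENNReal.ofReal C • (gaussianNoise 𝕋 s).map fun y => u + y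

lemma measurable_shiftMixture (C s : ℝ) :
    Measurable (shiftMixture (𝕋 := 𝕋) C s) := by
  refine Measure.measurable_of_measurable_coe _ fun A hA => ?_
  simp only [shiftMixture, Measure.add_apply, Measure.smul_apply, smul_eq_mul]
  refine measurable_const.add (Measurable.const_mul ?_ _)
  have : ∀ u : Compressed 𝕋, ((gaussianNoise 𝕋 s).map fun y => u + y) A =
      gaussianNoise 𝕋 s (Prod.mk u ⁻¹' ((fun q : Compressed 𝕋 × Compressed 𝕋 => q.1 + q.2) ⁻¹' A)) :=
    fun u => by rw [Measure.map_apply (by fun_prop) hA]; rfl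
  simp_rw [this]
  exact measurable_measure_prodMk_left (measurable_add hA)

/-- The law with density `eta1`. -/
def gaussianMixture (C σ : ℝ) : Measure ℝ :=
  ENNReal.ofReal (1 - C) • gaussianReal 0 (σ ^ 2).toNNReal +
    ENNReal.ofReal C • gaussianReal 1 (σ ^ 2).toNNReal

lemma isProbabilityMeasure_gaussianMixture {C : ℝ} (σ : ℝ) (hC0 : 0 ≤ C) (hC1 : C ≤ 1) :
    IsProbabilityMeasure (gaussianMixture C σ) := by
  refine ⟨?_⟩
  simp only [gaussianMixture, Measure.add_apply, Measure.smul_apply, measure_univ, smul_eq_mul,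
    mul_one]
  rw [← ENNReal.ofReal_add (by linarith) hC0]
  simp

lemma gaussianMixture_map_smul_conv_gaussianNoise {S σ C : ℝ} (hS : 0 < S) {u : Compressed 𝕋}
    (hu : ‖u‖ ≤ S) :
    ((gaussianMixture C σ).map fun x => x • u).conv
      ((gaussianNoise 𝕋 (S * σ)).map (splitMap S u)) = shiftMixture C (S * σ) u := by
  rw [gaussianMixture, Measure.map_add _ _ (by fun_prop), Measure.map_smul, Measure.map_smul,
    Measure.add_conv, Measure.conv_smul_left, Measure.conv_smul_left,
    gaussianReal_map_smul_conv_gaussianNoise hS hu, gaussianReal_map_smul_conv_gaussianNoise hS hu]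
  simp [shiftMixture]

end Gaussian

/-! ### The moments of the one-dimensional privacy loss -/

section Accountant

open Filter Topology

variable {C σ : ℝ}

/-- The privacy loss `log (η₁ / η₀)`. -/
def logRatio (C σ x : ℝ) : ℝ := Real.log ((1 - C) + C * Real.exp ((2 * x - 1) / (2 * σ ^ 2)))

lemma mixture_exp_pos (hC0 : 0 < C) (hC1 : C ≤ 1) (y : ℝ) : 0 < (1 - C) + C * Real.exp y := by
  have := Real.exp_pos y
  nlinarith [mul_pos hC0 this]

lemma exp_logRatio (hC0 : 0 < C) (hC1 : C ≤ 1) (x : ℝ) :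
    Real.exp (logRatio C σ x) = (1 - C) + C * Real.exp ((2 * x - 1) / (2 * σ ^ 2)) :=
  Real.exp_log (mixture_exp_pos hC0 hC1 _)

@[fun_prop]
lemma measurable_logRatio : Measurable (logRatio C σ) := by
  unfold logRatio
  fun_prop

/-- A weighted average of `1` and `exp y` lies between `exp (-|y|)` and `exp |y|`. The resulting
linear growth gives all exponential moments under a Gaussian. -/
lemma abs_logRatio_le (hC0 : 0 < C) (hC1 : C ≤ 1) (x : ℝ) :
    |logRatio C σ x| ≤ (2 * σ ^ 2)⁻¹ + (σ ^ 2)⁻¹ * |x| := by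
  have hpos := mixture_exp_pos hC0 hC1 ((2 * x - 1) / (2 * σ ^ 2))
  have h1 : |logRatio C σ x| ≤ |(2 * x - 1) / (2 * σ ^ 2)| := by
    rw [abs_le, logRatio, Real.le_log_iff_exp_le hpos, Real.log_le_iff_le_exp hpos]
    generalize (2 * x - 1) / (2 * σ ^ 2) = y
    have h2 : Real.exp (-|y|) ≤ 1 := Real.exp_le_one_iff.2 (by simp)
    have h3 : Real.exp (-|y|) ≤ Real.exp y := Real.exp_le_exp.2 (neg_abs_le y)
    have h4 : 1 ≤ Real.exp |y| := Real.one_le_exp (abs_nonneg y)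
    have h5 : Real.exp y ≤ Real.exp |y| := Real.exp_le_exp.2 (le_abs_self y)
    constructor <;> nlinarith
  refine h1.trans ?_
  rw [abs_div, abs_of_nonneg (by positivity : (0 : ℝ) ≤ 2 * σ ^ 2)]
  have h6 : |2 * x - 1| ≤ 2 * |x| + 1 := by
    refine (abs_sub _ _).trans ?_
    rw [abs_mul]
    simp
  calc |2 * x - 1| / (2 * σ ^ 2) ≤ (2 * |x| + 1) / (2 * σ ^ 2) := by gcongr
    _ = _ := by
      rw [add_div, mul_div_mul_left _ _ two_ne_zero, one_div, div_eq_inv_mul]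
      ring

lemma integrable_exp_mul_logRatio (hC0 : 0 < C) (hC1 : C ≤ 1) (t : ℝ) :
    Integrable (fun x => Real.exp (t * logRatio C σ x))
      (gaussianReal 0 (σ ^ 2).toNNReal) := by
  have h : Integrable (fun x => Real.exp (|t| * (σ ^ 2)⁻¹ * |x|))
      (gaussianReal 0 (σ ^ 2).toNNReal) :=
    integrable_exp_mul_abs (integrable_exp_mul_gaussianReal _) (integrable_exp_mul_gaussianReal _)
  refine (h.const_mul (Real.exp (|t| * (2 * σ ^ 2)⁻¹))).mono' (by fun_prop) (.of_forall fun x => ?_)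
  rw [Real.norm_eq_abs, Real.abs_exp, ← Real.exp_add, Real.exp_le_exp]
  calc t * logRatio C σ x ≤ |t| * |logRatio C σ x| := (le_abs_self _).trans (abs_mul _ _).le
    _ ≤ |t| * ((2 * σ ^ 2)⁻¹ + (σ ^ 2)⁻¹ * |x|) := by
      gcongr
      exact abs_logRatio_le hC0 hC1 x
    _ = _ := by ring

lemma toNNReal_sq_ne_zero (hσ : 0 < σ) : (σ ^ 2).toNNReal ≠ 0 := by
  simp [hσ.ne']

lemma eta0_pos (hσ : 0 < σ) (x : ℝ) : 0 < eta0 σ x :=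
  gaussianPDFReal_pos _ _ _ (toNNReal_sq_ne_zero hσ)

lemma eta1_eq (hσ : 0 < σ) (hC0 : 0 < C) (hC1 : C ≤ 1) (x : ℝ) :
    eta1 C σ x = eta0 σ x * Real.exp (logRatio C σ x) := by
  rw [exp_logRatio hC0 hC1]
  have h : gaussianPDFReal 1 (σ ^ 2).toNNReal x =
      gaussianPDFReal 0 (σ ^ 2).toNNReal x * Real.exp ((2 * x - 1) / (2 * σ ^ 2)) := by
    simp only [gaussianPDFReal, Real.coe_toNNReal _ (sq_nonneg σ)]
    rw [mul_assoc _ (Real.exp _), ← Real.exp_add]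
    congr 2
    field_simp
    ring
  rw [eta1, h, eta0]
  ring

lemma eta1_pos (hσ : 0 < σ) (hC0 : 0 < C) (hC1 : C ≤ 1) (x : ℝ) : 0 < eta1 C σ x := by
  rw [eta1_eq hσ hC0 hC1]
  exact mul_pos (eta0_pos hσ x) (Real.exp_pos _)

@[fun_prop]
lemma measurable_eta0 : Measurable (eta0 σ) := measurable_gaussianPDFReal _ _

@[fun_prop]
lemma measurable_eta1 : Measurable (eta1 C σ) :=
  ((measurable_gaussianPDFReal _ _).const_mul _).add ((measurable_gaussianPDFReal _ _).const_mul _)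

lemma eta0_moment_eq (hσ : 0 < σ) (hC0 : 0 < C) (hC1 : C ≤ 1) (lam x : ℝ) :
    eta0 σ x * (eta0 σ x / eta1 C σ x) ^ lam =
      eta0 σ x * Real.exp (-lam * logRatio C σ x) := by
  have h0 := (eta0_pos hσ x).ne'
  rw [eta1_eq hσ hC0 hC1, div_mul_cancel_left₀ h0, ← Real.exp_neg, ← Real.exp_mul]
  ring_nf

lemma eta1_moment_eq (hσ : 0 < σ) (hC0 : 0 < C) (hC1 : C ≤ 1) (lam x : ℝ) :
    eta1 C σ x * (eta1 C σ x / eta0 σ x) ^ lam =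
      eta0 σ x * Real.exp ((1 + lam) * logRatio C σ x) := by
  have h0 := (eta0_pos hσ x).ne'
  rw [eta1_eq hσ hC0 hC1, mul_div_cancel_left₀ _ h0, ← Real.exp_mul, mul_assoc, ← Real.exp_add]
  ring_nf

lemma integrable_eta0_mul_exp (hσ : 0 < σ) (hC0 : 0 < C) (hC1 : C ≤ 1) (t : ℝ) :
    Integrable fun x => eta0 σ x * Real.exp (t * logRatio C σ x) := by
  have h := integrable_exp_mul_logRatio (σ := σ) hC0 hC1 t
  rw [gaussianReal_of_var_ne_zero _ (toNNReal_sq_ne_zero hσ),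
    integrable_withDensity_iff_integrable_smul' (measurable_gaussianPDF _ _)
      (.of_forall fun x => gaussianPDF_lt_top)] at h
  simpa only [toReal_gaussianPDF, smul_eq_mul] using! h

lemma mgf_logRatio_eq (hσ : 0 < σ) (t : ℝ) :
    mgf (logRatio C σ) (gaussianReal 0 (σ ^ 2).toNNReal) t =
      ∫ x, eta0 σ x * Real.exp (t * logRatio C σ x) := by
  rw [mgf, integral_gaussianReal_eq_integral_smul (toNNReal_sq_ne_zero hσ)]
  rfl

/-- `E1` and `E2` are values of a single moment generating function, at `-lam` and `1 + lam`, so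
both inherit its continuity. -/
lemma E1_eq_mgf (hσ : 0 < σ) (hC0 : 0 < C) (hC1 : C ≤ 1) (lam : ℝ) :
    E1 lam C σ = mgf (logRatio C σ) (gaussianReal 0 (σ ^ 2).toNNReal) (-lam) := by
  rw [mgf_logRatio_eq hσ]
  exact integral_congr_ae (.of_forall fun x => eta0_moment_eq hσ hC0 hC1 lam x)

lemma E2_eq_mgf (hσ : 0 < σ) (hC0 : 0 < C) (hC1 : C ≤ 1) (lam : ℝ) :
    E2 lam C σ = mgf (logRatio C σ) (gaussianReal 0 (σ ^ 2).toNNReal) (1 + lam) := by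
  rw [mgf_logRatio_eq hσ]
  exact integral_congr_ae (.of_forall fun x => eta1_moment_eq hσ hC0 hC1 lam x)

lemma gaussianReal_eq_withDensity_eta0 (hσ : 0 < σ) :
    gaussianReal 0 (σ ^ 2).toNNReal = volume.withDensity fun x => ENNReal.ofReal (eta0 σ x) :=
  gaussianReal_of_var_ne_zero _ (toNNReal_sq_ne_zero hσ)

lemma gaussianMixture_eq_withDensity_eta1 (hσ : 0 < σ) (hC0 : 0 < C) (hC1 : C ≤ 1) :
    gaussianMixture C σ = volume.withDensity fun x => ENNReal.ofReal (eta1 C σ x) := by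
  rw [gaussianMixture, gaussianReal_of_var_ne_zero _ (toNNReal_sq_ne_zero hσ),
    gaussianReal_of_var_ne_zero _ (toNNReal_sq_ne_zero hσ),
    ← withDensity_smul _ (measurable_gaussianPDF _ _),
    ← withDensity_smul _ (measurable_gaussianPDF _ _),
    ← withDensity_add_left ((measurable_gaussianPDF _ _).const_smul _)]
  congr 1
  funext x
  simp only [Pi.add_apply, Pi.smul_apply, smul_eq_mul, gaussianPDF, eta1]
  have hC : 0 ≤ 1 - C := by linarith
  rw [ENNReal.ofReal_add (mul_nonneg hC (gaussianPDFReal_nonneg _ _ _))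
    (mul_nonneg hC0.le (gaussianPDFReal_nonneg _ _ _)), ENNReal.ofReal_mul hC,
    ENNReal.ofReal_mul hC0.le]

/-- The larger of the two moments. -/
def maxMoment (lam C σ : ℝ) : ℝ := max (E1 lam C σ) (E2 lam C σ)

lemma holderBound_gaussianReal_gaussianMixture (hσ : 0 < σ) (hC0 : 0 < C) (hC1 : C ≤ 1) {lam : ℝ}
    (hlam : 0 < lam) :
    HolderBound (ENNReal.ofReal (maxMoment lam C σ) ^ (1 / (1 + lam))) ((1 + lam) / lam)
      (gaussianReal 0 (σ ^ 2).toNNReal) (gaussianMixture C σ) := by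
  rw [gaussianReal_eq_withDensity_eta0 hσ, gaussianMixture_eq_withDensity_eta1 hσ hC0 hC1]
  refine (HolderBound.of_density measurable_eta0 measurable_eta1 (eta0_pos hσ)
    (eta1_pos hσ hC0 hC1) hlam ?_).mono ?_
  · simp_rw [eta0_moment_eq hσ hC0 hC1]
    exact integrable_eta0_mul_exp hσ hC0 hC1 _
  · gcongr
    exact le_max_left _ _

lemma holderBound_gaussianMixture_gaussianReal (hσ : 0 < σ) (hC0 : 0 < C) (hC1 : C ≤ 1) {lam : ℝ}
    (hlam : 0 < lam) :
    HolderBound (ENNReal.ofReal (maxMoment lam C σ) ^ (1 / (1 + lam))) ((1 + lam) / lam)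
      (gaussianMixture C σ) (gaussianReal 0 (σ ^ 2).toNNReal) := by
  rw [gaussianReal_eq_withDensity_eta0 hσ, gaussianMixture_eq_withDensity_eta1 hσ hC0 hC1]
  refine (HolderBound.of_density measurable_eta1 measurable_eta0 (eta1_pos hσ hC0 hC1)
    (eta0_pos hσ) hlam ?_).mono ?_
  · simp_rw [eta1_moment_eq hσ hC0 hC1]
    exact integrable_eta0_mul_exp hσ hC0 hC1 _
  · gcongr
    exact le_max_right _ _

/-- The constant function `1` is a test function for two probability measures. This keeps the
logarithm in `alpha` away from its default values and makes `alpha` nonnegative. -/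
lemma one_le_maxMoment (hσ : 0 < σ) (hC0 : 0 < C) (hC1 : C ≤ 1) {lam : ℝ} (hlam : 0 < lam) :
    1 ≤ maxMoment lam C σ := by
  have := isProbabilityMeasure_gaussianMixture σ hC0.le hC1
  have h := (holderBound_gaussianReal_gaussianMixture hσ hC0 hC1 hlam).one_le
  by_contra! hlt
  have h1 : ENNReal.ofReal (maxMoment lam C σ) < 1 := by simpa using hlt
  exact absurd h (not_le.2 (ENNReal.rpow_lt_one h1 (by positivity)))

lemma exp_alpha (hσ : 0 < σ) (hC0 : 0 < C) (hC1 : C ≤ 1) {lam : ℝ} (hlam : 0 < lam) :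
    Real.exp (alpha lam C σ) = maxMoment lam C σ :=
  Real.exp_log (zero_lt_one.trans_le (one_le_maxMoment hσ hC0 hC1 hlam))

lemma alpha_nonneg (hσ : 0 < σ) (hC0 : 0 < C) (hC1 : C ≤ 1) {lam : ℝ} (hlam : 0 < lam) :
    0 ≤ alpha lam C σ :=
  Real.log_nonneg (one_le_maxMoment hσ hC0 hC1 hlam)

/-! ### Attainment of the minimum over `lam` -/

lemma continuousOn_alpha (hσ : 0 < σ) (hC0 : 0 < C) (hC1 : C ≤ 1) :
    ContinuousOn (fun lam => alpha lam C σ) (Set.Ioi 0) := by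
  have hM : Continuous (mgf (logRatio C σ) (gaussianReal 0 (σ ^ 2).toNNReal)) :=
    continuous_mgf fun t => integrable_exp_mul_logRatio hC0 hC1 t
  refine ContinuousOn.log ?_ fun lam hlam =>
    (zero_lt_one.trans_le (one_le_maxMoment hσ hC0 hC1 hlam)).ne'
  simp_rw [E1_eq_mgf hσ hC0 hC1, E2_eq_mgf hσ hC0 hC1]
  exact Continuous.continuousOn (by fun_prop)

/-- Dropping the summand `1 - C` leaves `η₁/η₀ ≥ C exp((2x - 1)/(2σ²))`, whose moment is an explicit
Gaussian integral. The bound is quadratic in `lam`, enough to survive division by `lam`. -/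
lemma le_alpha (hσ : 0 < σ) (hC0 : 0 < C) (hC1 : C ≤ 1) {lam : ℝ} (hlam : 0 < lam) :
    (1 + lam) * (Real.log C + lam / (2 * σ ^ 2)) ≤ alpha lam C σ := by
  have h1 : Real.exp ((1 + lam) * (Real.log C + lam / (2 * σ ^ 2))) ≤ E2 lam C σ := by
    have hid := mgf_gaussianReal (p := gaussianReal 0 (σ ^ 2).toNNReal) (X := id) (μ := 0)
      (v := (σ ^ 2).toNNReal) Measure.map_id ((1 + lam) / σ ^ 2)
    rw [Real.coe_toNNReal _ (sq_nonneg σ)] at hid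
    have hint : Integrable (fun x => Real.exp ((1 + lam) / σ ^ 2 * x))
        (gaussianReal 0 (σ ^ 2).toNNReal) := integrable_exp_mul_gaussianReal _
    calc Real.exp ((1 + lam) * (Real.log C + lam / (2 * σ ^ 2)))
        = Real.exp ((1 + lam) * (Real.log C - (2 * σ ^ 2)⁻¹)) *
            mgf id (gaussianReal 0 (σ ^ 2).toNNReal) ((1 + lam) / σ ^ 2) := by
          rw [hid, ← Real.exp_add]
          congr 1
          field_simp
          ring
      _ = ∫ x, Real.exp ((1 + lam) * (Real.log C - (2 * σ ^ 2)⁻¹)) *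
            Real.exp ((1 + lam) / σ ^ 2 * x) ∂gaussianReal 0 (σ ^ 2).toNNReal := by
          rw [integral_const_mul]
          rfl
      _ ≤ mgf (logRatio C σ) (gaussianReal 0 (σ ^ 2).toNNReal) (1 + lam) := by
          refine integral_mono (hint.const_mul _) (integrable_exp_mul_logRatio hC0 hC1 _)
            fun x => ?_
          simp only
          rw [← Real.exp_add, Real.exp_le_exp]
          have h2 : Real.log C + (2 * x - 1) / (2 * σ ^ 2) ≤ logRatio C σ x := by
            rw [logRatio, Real.le_log_iff_exp_le (mixture_exp_pos hC0 hC1 _), Real.exp_add,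
              Real.exp_log hC0]
            linarith
          calc _ = (1 + lam) * (Real.log C + (2 * x - 1) / (2 * σ ^ 2)) := by
                field_simp
                ring
            _ ≤ _ := by gcongr
      _ = _ := (E2_eq_mgf hσ hC0 hC1 lam).symm
  rw [alpha, ← maxMoment, Real.le_log_iff_exp_le (zero_lt_one.trans_le (one_le_maxMoment hσ hC0 hC1 hlam))]
  exact h1.trans (le_max_right _ _)

/-- The minimum defining `ε` is attained. -/
lemma exists_isLeast_epsilon (hσ : 0 < σ) (hC0 : 0 < C) (hC1 : C ≤ 1) {T : ℝ} (hT : 1 ≤ T)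
    {δ : ℝ} (hδ0 : 0 < δ) (hδ1 : δ < 1) :
    ∃ ε : ℝ, IsLeast {e : ℝ | ∃ lam : ℝ, 0 < lam ∧
      e = (T * alpha lam C σ - Real.log δ) / lam} ε := by
  set h : ℝ → ℝ := fun lam => (T * alpha lam C σ - Real.log δ) / lam with hh
  have hlogδ : 0 < -Real.log δ := by linarith [Real.log_neg hδ0 hδ1]
  have hcont : ContinuousOn h (Set.Ioi 0) :=
    ((continuousOn_const.mul (continuousOn_alpha hσ hC0 hC1)).sub continuousOn_const).div
      continuousOn_id fun x hx => (ne_of_gt hx)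
  -- The substitution `lam = exp s` moves the problem to the whole line, where a continuous function
  -- tending to `∞` at both ends attains its minimum.
  have hcont' : Continuous fun s => h (Real.exp s) :=
    hcont.comp_continuous Real.continuous_exp fun s => Real.exp_pos s
  have hbot : Tendsto (fun s => h (Real.exp s)) atBot atTop := by
    refine tendsto_atTop_mono (f := fun s => -Real.log δ * Real.exp (-s)) (fun s => ?_)
      ((Real.tendsto_exp_atTop.comp tendsto_neg_atBot_atTop).const_mul_atTop hlogδ)
    rw [Real.exp_neg, ← div_eq_mul_inv]
    have := mul_nonneg (zero_le_one.trans hT) (alpha_nonneg hσ hC0 hC1 (Real.exp_pos s))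
    simp only [hh]
    gcongr
    linarith
  have htop : Tendsto (fun s => h (Real.exp s)) atTop atTop := by
    refine Tendsto.comp (g := h) ?_ Real.tendsto_exp_atTop
    -- For `lam ≥ 1`, `1 + lam ≤ 2 * lam` and `log C ≤ 0` give the term `2 * log C`; `1 ≤ T` and
    -- `alpha ≥ 0` allow replacing `T * alpha` by `alpha`.
    refine tendsto_atTop_mono' atTop (f₁ := fun lam => 2 * Real.log C + (2 * σ ^ 2)⁻¹ * lam) ?_
      (tendsto_atTop_add_const_left _ _ (tendsto_id.const_mul_atTop (by positivity)))
    filter_upwards [eventually_ge_atTop 1] with lam hlam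
    have hlam0 : 0 < lam := by linarith
    have h1 := le_alpha hσ hC0 hC1 hlam0
    have h2 := alpha_nonneg hσ hC0 hC1 hlam0
    have h3 : Real.log C ≤ 0 := Real.log_nonpos hC0.le hC1
    simp only [hh]
    rw [le_div_iff₀ hlam0]
    have h4 : 0 ≤ lam / (2 * σ ^ 2) := by positivity
    have h5 : (2 * σ ^ 2)⁻¹ * lam = lam / (2 * σ ^ 2) := by rw [div_eq_inv_mul]
    rw [h5]
    nlinarith [mul_nonneg (sub_nonneg.2 hT) h2, mul_nonneg (neg_nonneg.2 h3) (sub_nonneg.2 hlam)]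
  obtain ⟨s, hs⟩ := hcont'.exists_forall_le (by
    rw [cocompact_eq_atBot_atTop]
    exact hbot.sup htop)
  refine ⟨h (Real.exp s), ⟨Real.exp s, Real.exp_pos s, rfl⟩, ?_⟩
  rintro _ ⟨lam, hlam, rfl⟩
  simpa [Real.exp_log hlam] using hs (Real.log lam)

end Accountant

/-! ### Privacy of the protocol -/

lemma sumKernel_apply {α E : Type*} [MeasurableSpace α] [MeasurableSpace E] [Add E]
    [MeasurableAdd₂ E] (κ ξ : Kernel α E) [IsSFiniteKernel κ] [IsSFiniteKernel ξ] (v : α) :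
    sumKernel κ ξ v = Measure.map (fun q : E × E => q.1 + q.2) ((κ v).prod (ξ v)) := by
  rw [sumKernel, Kernel.map_apply _ measurable_add, Kernel.prod_apply]

lemma norm_clip_le {n : ℕ} (𝕋 : Finset (Fin n)) {S : ℝ} (hS : 0 < S) (v : Compressed 𝕋) :
    ‖clip 𝕋 S v‖ ≤ S := by
  have hpos : 0 < max 1 (‖v‖ / S) := zero_lt_one.trans_le (le_max_left _ _)
  rw [clip, norm_smul, norm_inv, Real.norm_of_nonneg hpos.le, inv_mul_le_iff₀ hpos,
    ← div_le_iff₀ hS]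
  exact le_max_right _ _

namespace Params

variable {X : Type*} {n : ℕ} (P : Params X n)

/-! ### One round with one extra client -/

lemma sumOfUpdates_cons (d : ClientData X) (D : Database X) (v : Compressed P.top) :
    P.sumOfUpdates (d :: D) v = (P.contributionKernel d v).conv (P.sumOfUpdates D v) :=
  sumKernel_apply _ _ v

/-- Independent contributions convolve commutatively, so the position of the extra client is
immaterial. -/
lemma sumOfUpdates_append_cons (l₁ l₂ : Database X) (d : ClientData X) (v : Compressed P.top) :
    P.sumOfUpdates (l₁ ++ d :: l₂) v =
      (P.contributionKernel d v).conv (P.sumOfUpdates (l₁ ++ l₂) v) := by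
  induction l₁ with
  | nil => exact P.sumOfUpdates_cons d l₂ v
  | cons a l ih =>
    rw [List.cons_append, List.cons_append, sumOfUpdates_cons, sumOfUpdates_cons, ih,
      ← Measure.conv_assoc, ← Measure.conv_assoc,
      Measure.conv_comm (P.contributionKernel a v)]

lemma roundKernel_apply (D : Database X) (v : Compressed P.top) :
    P.roundKernel D v = (P.sumOfUpdates D v).conv (gaussianNoise P.top (P.S * P.σ)) :=
  sumKernel_apply _ _ v

lemma roundKernel_append_cons (l₁ l₂ : Database X) (d : ClientData X) (v : Compressed P.top) :
    P.roundKernel (l₁ ++ d :: l₂) v = (P.sumOfUpdates (l₁ ++ l₂) v).conv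
      ((P.contributionKernel d v).conv (gaussianNoise P.top (P.S * P.σ))) := by
  rw [roundKernel_apply, sumOfUpdates_append_cons, Measure.conv_comm (P.contributionKernel d v),
    Measure.conv_assoc]

lemma ae_norm_le_clientKernel (d : ClientData X) (v : Compressed P.top) :
    ∀ᵐ u ∂P.clientKernel d v, ‖u‖ ≤ P.S := by
  change ∀ᵐ u ∂((P.sgdKernel d P.Tgd (expand P.top P.w₀ v)).map
    fun w' => clip P.top P.S (compress P.top (w' - expand P.top P.w₀ v))), ‖u‖ ≤ P.S
  rw [ae_map_iff (by fun_prop) (measurableSet_le (by fun_prop) (by fun_prop))]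
  exact .of_forall fun _ => norm_clip_le _ P.S_pos _

/-- Conditioning on the clipped update `u` before the sampling coin is tossed leaves a mixture of
unshifted noise and noise shifted by `u`. -/
lemma contributionKernel_conv_gaussianNoise (d : ClientData X) (v : Compressed P.top) (s : ℝ) :
    (P.contributionKernel d v).conv (gaussianNoise P.top s) =
      (P.clientKernel d v).bind (shiftMixture P.C s) := by
  change (ENNReal.ofReal (1 - P.C) • Measure.dirac 0 +
    ENNReal.ofReal P.C • P.clientKernel d v).conv _ = _
  rw [Measure.add_conv, Measure.conv_smul_left, Measure.conv_smul_left, Measure.dirac_zero_conv]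
  ext A hA
  rw [Measure.bind_apply hA (measurable_shiftMixture _ _).aemeasurable]
  simp only [shiftMixture, Measure.add_apply, Measure.smul_apply, smul_eq_mul]
  rw [lintegral_add_left measurable_const, lintegral_const, measure_univ, mul_one,
    lintegral_const_mul' _ _ ENNReal.ofReal_ne_top, Measure.conv,
    Measure.map_apply measurable_add hA, Measure.prod_apply (measurable_add hA)]
  congr 2
  refine lintegral_congr fun u => ?_
  rw [Measure.map_apply (by fun_prop) hA]
  rfl

/-- The Hölder constant of one round. -/
def roundConst (lam : ℝ) : ℝ≥0∞ := ENNReal.ofReal (maxMoment lam P.C P.σ) ^ (1 / (1 + lam))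

variable {P} {lam : ℝ}

lemma one_lt_exponent (hlam : 0 < lam) : 1 < (1 + lam) / lam := by
  rw [lt_div_iff₀ hlam]
  linarith

lemma one_le_roundConst (hlam : 0 < lam) : 1 ≤ P.roundConst lam :=
  ENNReal.one_le_rpow (by simpa using one_le_maxMoment P.σ_pos P.C_pos P.C_le_one hlam)
    (by positivity)

/-- A trivial mixture over the same law of `u`, so that `HolderBound.bind` can compare the two sides
for each fixed `u`. -/
lemma gaussianNoise_eq_bind (d : ClientData X) (v : Compressed P.top) :
    gaussianNoise P.top (P.S * P.σ) =
      (P.clientKernel d v).bind fun _ => gaussianNoise P.top (P.S * P.σ) := by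
  rw [Measure.bind_const]
  simp

lemma gaussianNoise_eq_conv {u : Compressed P.top} (hu : ‖u‖ ≤ P.S) :
    gaussianNoise P.top (P.S * P.σ) =
      ((gaussianReal 0 (P.σ ^ 2).toNNReal).map fun x => x • u).conv
        ((gaussianNoise P.top (P.S * P.σ)).map (splitMap P.S u)) := by
  rw [gaussianReal_map_smul_conv_gaussianNoise P.S_pos hu]
  simp

/-- Post-processing that turns laws on the line into laws of a noisy sum with one extra client of
update `u`. -/
lemma holderBound_conv_splitMap {K : ℝ≥0∞} {q : ℝ} (hq : 1 < q) {μ ν : Measure ℝ}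
    [IsProbabilityMeasure μ] [IsProbabilityMeasure ν] (h : HolderBound K q μ ν)
    (u : Compressed P.top) :
    HolderBound K q
      ((μ.map fun x => x • u).conv ((gaussianNoise P.top (P.S * P.σ)).map (splitMap P.S u)))
      ((ν.map fun x => x • u).conv ((gaussianNoise P.top (P.S * P.σ)).map (splitMap P.S u))) := by
  have := Measure.isProbabilityMeasure_map (μ := μ) (f := fun x => x • u) (by fun_prop)
  have := Measure.isProbabilityMeasure_map (μ := ν) (f := fun x => x • u) (by fun_prop)
  have := Measure.isProbabilityMeasure_map (μ := gaussianNoise P.top (P.S * P.σ))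
    (f := splitMap P.S u) (by fun_prop)
  rw [Measure.conv_comm, Measure.conv_comm (ν.map _)]
  exact HolderBound.conv_left hq (h.map (by fun_prop))

lemma holderBound_roundKernel_append_cons_left (hlam : 0 < lam) (l₁ l₂ : Database X)
    (d : ClientData X) (v : Compressed P.top) :
    HolderBound (P.roundConst lam) ((1 + lam) / lam)
      (P.roundKernel (l₁ ++ d :: l₂) v) (P.roundKernel (l₁ ++ l₂) v) := by
  have := isProbabilityMeasure_gaussianMixture P.σ P.C_pos.le P.C_le_one
  rw [roundKernel_append_cons, roundKernel_apply]
  refine HolderBound.conv_left (one_lt_exponent hlam) ?_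
  rw [contributionKernel_conv_gaussianNoise]
  rw [gaussianNoise_eq_bind d v]
  refine HolderBound.bind (one_lt_exponent hlam) (measurable_shiftMixture _ _) measurable_const ?_
  filter_upwards [P.ae_norm_le_clientKernel d v] with u hu
  rw [← gaussianMixture_map_smul_conv_gaussianNoise P.S_pos hu]
  nth_rw 2 [gaussianNoise_eq_conv hu]
  exact holderBound_conv_splitMap (one_lt_exponent hlam)
    (holderBound_gaussianMixture_gaussianReal P.σ_pos P.C_pos P.C_le_one hlam) u

lemma holderBound_roundKernel_append_cons_right (hlam : 0 < lam) (l₁ l₂ : Database X)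
    (d : ClientData X) (v : Compressed P.top) :
    HolderBound (P.roundConst lam) ((1 + lam) / lam)
      (P.roundKernel (l₁ ++ l₂) v) (P.roundKernel (l₁ ++ d :: l₂) v) := by
  have := isProbabilityMeasure_gaussianMixture P.σ P.C_pos.le P.C_le_one
  rw [roundKernel_append_cons, roundKernel_apply]
  refine HolderBound.conv_left (one_lt_exponent hlam) ?_
  rw [contributionKernel_conv_gaussianNoise]
  rw [gaussianNoise_eq_bind d v]
  refine HolderBound.bind (one_lt_exponent hlam) measurable_const (measurable_shiftMixture _ _) ?_
  filter_upwards [P.ae_norm_le_clientKernel d v] with u hu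
  rw [← gaussianMixture_map_smul_conv_gaussianNoise P.S_pos hu]
  nth_rw 1 [gaussianNoise_eq_conv hu]
  exact holderBound_conv_splitMap (one_lt_exponent hlam)
    (holderBound_gaussianReal_gaussianMixture P.σ_pos P.C_pos P.C_le_one hlam) u

lemma holderBound_roundKernel (hlam : 0 < lam) {D D' : Database X} (hD : ClientAdjacent D D')
    (v : Compressed P.top) :
    HolderBound (P.roundConst lam) ((1 + lam) / lam) (P.roundKernel D v) (P.roundKernel D' v) := by
  rcases hD with rfl | ⟨l₁, l₂, d, ⟨rfl, rfl⟩ | ⟨rfl, rfl⟩⟩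
  · exact (HolderBound.refl (one_lt_exponent hlam)).mono (one_le_roundConst hlam)
  · exact holderBound_roundKernel_append_cons_left hlam l₁ l₂ d v
  · exact holderBound_roundKernel_append_cons_right hlam l₁ l₂ d v

/-! ### Adaptive composition of the rounds -/

lemma viewKernel_succ_apply (D : Database X) (t : ℕ) (w : Weights n) :
    P.viewKernel D (t + 1) w = ((P.roundKernel D (compress P.top w)) ⊗ₘ
      ((P.viewKernel D t).comap (P.serverUpdate w)
        (P.measurable_serverUpdate.comp measurable_prodMk_left))).map
          fun q => (Fin.cons q.1 q.2 : Fin (t + 1) → Compressed P.top) := by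
  rw [viewKernel, Kernel.map_apply _ (measurable_cons t), Kernel.compProd_apply_eq_compProd_sectR]
  rfl

/-- The induction runs over all starting models, since the remaining rounds start from a model that
depends on the first output. -/
lemma holderBound_viewKernel (hlam : 0 < lam) {D D' : Database X} (hD : ClientAdjacent D D')
    (t : ℕ) (w : Weights n) :
    HolderBound (P.roundConst lam ^ t) ((1 + lam) / lam)
      (P.viewKernel D t w) (P.viewKernel D' t w) := by
  induction t generalizing w with
  | zero =>
    rw [pow_zero]
    exact HolderBound.refl (one_lt_exponent hlam)
  | succ t ih =>
    rw [viewKernel_succ_apply, viewKernel_succ_apply, pow_succ']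
    exact ((holderBound_roundKernel hlam hD _).compProd (one_lt_exponent hlam)
      fun y => ih (P.serverUpdate w y)).map (measurable_cons t)

lemma roundConst_pow (hlam : 0 < lam) (t : ℕ) :
    P.roundConst lam ^ t =
      ENNReal.ofReal (Real.exp (t * alpha lam P.C P.σ)) ^ (1 / (1 + lam)) := by
  rw [roundConst, ← exp_alpha P.σ_pos P.C_pos P.C_le_one hlam, Real.exp_nat_mul,
    ENNReal.ofReal_pow (Real.exp_pos _).le, ← ENNReal.rpow_natCast, ← ENNReal.rpow_natCast,
    ← ENNReal.rpow_mul, ← ENNReal.rpow_mul, mul_comm]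

/-- The tail bound for every order `lam`. -/
lemma isDP_mechanism (hlam : 0 < lam) {δ : ℝ} (hδ0 : 0 < δ) :
    IsDP ClientAdjacent P.mechanism
      (((P.Tcl : ℝ) * alpha lam P.C P.σ - Real.log δ) / lam) δ := by
  intro D D' hD
  have : IsProbabilityMeasure (P.mechanism D) := by unfold mechanism; infer_instance
  have : IsProbabilityMeasure (P.mechanism D') := by unfold mechanism; infer_instance
  have h := holderBound_viewKernel (P := P) hlam hD P.Tcl P.w₀
  rw [roundConst_pow hlam] at h
  refine (HolderBound.measure_lt_privacyLoss_le (μ := P.mechanism D) (ν := P.mechanism D')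
    hlam (Real.exp_pos _).le h _).trans_eq ?_
  -- This `ε` is the one for which `exp (Tα) * exp (-(ε * lam))` equals `δ`.
  rw [div_mul_cancel₀ _ hlam.ne', ← Real.exp_add, neg_sub, add_sub_cancel, Real.exp_log hδ0]

end Params

end FLTop

end

theorem theorem1 {X : Type*} {n : ℕ} (P : FLTop.Params X n) (hT : 1 ≤ P.Tcl)
    (δ : ℝ) (hδ0 : 0 < δ) (hδ1 : δ < 1) :
    ∃ ε : ℝ,
      IsLeast {e : ℝ | ∃ lam : ℝ, 0 < lam ∧
        e = ((P.Tcl : ℝ) * FLTop.alpha lam P.C P.σ - Real.log δ) / lam} ε ∧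
      FLTop.IsDP FLTop.ClientAdjacent P.mechanism ε δ := by
  obtain ⟨ε, hε⟩ := FLTop.exists_isLeast_epsilon P.σ_pos P.C_pos P.C_le_one
    (T := P.Tcl) (by exact_mod_cast hT) hδ0 hδ1
  refine ⟨ε, hε, ?_⟩
  -- Because the minimum is attained, the tail bound at the minimizing order is already the claim.
  obtain ⟨lam, hlam, rfl⟩ := hε.1
  exact FLTop.Params.isDP_mechanism hlam hδ0
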